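/- **Setting.** A *PCM* is a set $M$ with a partial, commutative, associative operation $\bullet$ and a unit. An *$(M,T)$-state* is a triple $s=(a_s,a_j,a_o)$ with $a_s,a_o\in M$ (*self*, *other*) and $a_j\in T$ (*joint*). Put $s\lhd p=(a_s\bullet p,a_j,a_o)$, $s\rhd p=(a_s,a_j,p\bullet a_o)$ (when defined), and $s^\top=(a_o,a_j,a_s)$. A predicate (or partial function) is *global* if it does not distinguish $s\rhd p$ from $s\lhd p$ whenever both are defined. A *state space* $\Sigma$ is a global predicate that implies that $a_s\bullet a_o$ is defined, together with an erasure into heaps, global and defined on $\Sigma$. A *transition* is a relation $t$ on $\Sigma$ that is functional, preserves $a_o$, and is local: if $t\,(s\rhd p)\,x$, then $x=s'\rhd p$ and $t\,(s\lhd p)\,(s'\lhd p)$ for some $s'$. A *resource* $V=(M,T,\Sigma,\Delta)$ has a set $\Delta$ of transitions that preserve the set of pointers of the erased heap. An *action* of type $A$ in $V$ is a partial function $a:\Sigma(V)\rightharpoonup\Delta(V)\times A$ such that $a(s\rhd p)=(t,v)$ implies $a(s\lhd p)=(t,v)$; $[a]\,s=(s',v)$ means that $a\,s=(t,v)$ and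 $t\,s\,s'$ for some $t$. Write $s\to_V s'$ (other-step) if $t\,s^\top s'^\top$ for some $t\in\Delta(V)$; $\to_V^*$ is its reflexive-transitive closure, and $Q^{\circ}(s)$ (stabilization) means $\forall s'.\ s\to_V^*s'\Rightarrow Q\,s'$. Finally $(P * Q)(s)$ means that $s=(a_1\bullet a_2,a_j,a_3)$, $P(a_1,a_j,a_2\bullet a_3)$ and $Q(a_2,a_j,a_3\bullet a_1)$ for some $a_1,a_2,a_3,a_j$. A *morphism* $f:V\to W$ consists of partial functions $f_\Sigma:\Sigma(W)\rightharpoonup\Sigma(V)$ and $f_\Delta:\Sigma(W)\rightharpoonup\Delta(V)\rightharpoonup\Delta(W)$ such that (1) for some function $\phi:M(W)\to M(V)$, if $s_v=f_\Sigma(s_w\rhd p)$, then there is $s_v'$ with $s_v=s_v'\rhd\phi(p)$ and $s_v'\lhd\phi(p)=f_\Sigma(s_w\lhd p)$; (2) $f_\Delta(s_w\rhd p)(t_v)=t_w$ implies $f_\Delta(s_w\lhd p)(t_v)=t_w$; (3) if $a_o(s_w)=a_o(s_w')$ and $f_\Sigma s_w$, $f_\Sigma s_w'$ exist, then $a_o(f_\Sigma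 s_w)=a_o(f_\Sigma s_w')$. An *$f$-simulation* is a predicate $I$ on $W$-states such that, whenever $I\,s_w$ and $s_v=f_\Sigma s_w$ exists: (1) if $t_v\,s_v\,s_v'$ with $t_v\in\Delta(V)$, then $t_w=f_\Delta\,s_w\,t_v$ exists and there is $s_w'$ with $t_w\,s_w\,s_w'$, $I\,s_w'$ and $f_\Sigma s_w'=s_v'$; (2) if $s_w\to_W^*s_w'$, then $I\,s_w'$, and $f_\Sigma s_w'$ exists with $s_v\to_V^*f_\Sigma s_w'$. An *invariant* is a simulation for the identity morphism. Put $\hat f R\,(s_w)\iff\exists s_v.\ s_v=f_\Sigma s_w\wedge R\,s_v$. An *indexed family* over a set $X$ has $f_\Sigma$, $f_\Delta$ with an extra argument $x\in X$; (1) (with one $\phi$ for all $x$) and (2) are required for every $x$, (3) for $f_\Sigma\,x\,s_w$ and $f_\Sigma\,x'\,s_w'$ with arbitrary $x,x'$, and moreover $f_\Sigma\,x_1\,s_1=f_\Sigma\,x_2\,s_2$ (both defined) implies $x_1=x_2$. Its simulations $I\,x\,s_w$ satisfy (1) with some new index $x'$ for $s_w'$, and (2) with $x$ unchanged; $\hat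 f_xR$ is the lifting along $f_\Sigma\,x$. **Denotational semantics.** *Action trees* over $V$ with results in $A$ are generated by $\mathsf{Unfinished}$, $\mathsf{Ret}\,v$, $\mathsf{Act}\,a$, $\mathsf{Seq}\,T\,K$, $\mathsf{Par}\,T_1\,T_2\,K$ and $\mathsf{Morph}\,f\,x\,T$ ($f$ a family from $U$ to $V$, $x$ an index, $T$ a tree over $U$). They reduce, at a chosen redex, by: $\mathsf{Act}\,a$ moves $s$ to $s'$ by $t$ and becomes $\mathsf{Ret}\,v$, if $a\,s=(t,v)$ and $t\,s\,s'$; silently, $\mathsf{Seq}(\mathsf{Ret}\,v)K$ becomes $K\,v$, $\mathsf{Par}(\mathsf{Ret}\,v_1)(\mathsf{Ret}\,v_2)K$ becomes $K(v_1,v_2)$, and $\mathsf{Morph}\,f\,x\,(\mathsf{Ret}\,v)$ becomes $\mathsf{Ret}\,v$; reduction is closed under $\mathsf{Seq}$ (first argument) and $\mathsf{Par}$ (either argument); $\mathsf{Morph}\,f\,x\,T$ becomes $\mathsf{Morph}\,f\,x\,T'$ silently if $T$ becomes $T'$ silently, and it moves $s_w$ to $s_w'$ by $t_w=f_\Delta\,x\,s_w\,t_v$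 and becomes $\mathsf{Morph}\,f\,x'\,T'$ if $T$, becoming $T'$, moves $f_\Sigma\,x\,s_w$ to $s_v'$ by $t_v$, where $t_w\,s_w\,s_w'$ and $f_\Sigma\,x'\,s_w'=s_v'$. A *program* $e:\mathsf{ST}\,V\,A$ is a set of such trees containing $\mathsf{Unfinished}$; $\mathsf{ret}\,v$, $\langle a\rangle$, $x\leftarrow e_1;(e_2\,x)$, $e_1\parallel e_2$, $\mathsf{morph}\,f\,x\,e$ are the sets of the corresponding trees together with $\mathsf{Unfinished}$ (the continuation of $\parallel$ being $\mathsf{Ret}$), and $\mathsf{morph}\,f\,e$, for a morphism $f$, is $\mathsf{morph}$ for $f$ regarded as a family over the one-point set. For a set $T$ of (dependent) functions from $A$ to programs and $F:T\to T$, $\mathsf{fix}\,F$ is the pointwise least fixed point of $e\mapsto\bigcup_{e'\in T,\,e'\subseteq e}F\,e'$. For $e:\mathsf{ST}\,V\,A$ and $Q$ a predicate on $A\times\Sigma(V)$, $\mathsf{vrf}\,e\,Q\,s$ holds if for every tree in $e$, every configuration that is reachable from it and $s$ by its reductions, interleaved with arbitrary other-steps of $V$, has no stuck redex, and satisfies $Q\,v\,s'$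 if it consists of the tree $\mathsf{Ret}\,v$ and the state $s'$. The Hoare type $[\Gamma].\{P\}A\{Q\}@V$ is the set of all $e:\mathsf{ST}\,V\,A$ such that $P_\gamma\,s\Rightarrow\mathsf{vrf}\,e\,Q_\gamma\,s$ for all $\gamma\in\Gamma$ and $s\in\Sigma(V)$. **Theorem (soundness).** For all resources $V,W$, programs $e:\mathsf{ST}\,V\,A$, $e_i:\mathsf{ST}\,V\,A_i$ (and $e_2:A_1\to\mathsf{ST}\,V\,A_2$ in $\mathsf{vrf\_bnd}$), actions $a$ in $V$, morphisms $f:V\to W$, $f$-simulations $I$, invariants $J$ of $V$, states $s\in\Sigma(V)$, $s_w\in\Sigma(W)$, and postconditions $Q,Q_1,Q_2$ (in $\mathsf{vrf\_frame}$, $Q_2$ is a predicate on states only): - ($\mathsf{vrf\_post}$) if $\forall v\,s'.\ J\,s'\to Q_1\,v\,s'\to Q_2\,v\,s'$, $J\,s$ and $\mathsf{vrf}\,e\,Q_1\,s$, then $\mathsf{vrf}\,e\,Q_2\,s$; - ($\mathsf{vrf\_ret}$) $(Q\,v)^\circ s\to\mathsf{vrf}\,(\mathsf{ret}\,v)\,Q\,s$;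 - ($\mathsf{vrf\_bnd}$) $\mathsf{vrf}\,e_1\,(\lambda x.\,\mathsf{vrf}\,(e_2\,x)\,Q)\,s\to\mathsf{vrf}\,(x\leftarrow e_1;(e_2\,x))\,Q\,s$; - ($\mathsf{vrf\_par}$) $(\mathsf{vrf}\,e_1\,Q_1 * \mathsf{vrf}\,e_2\,Q_2)\,s\to\mathsf{vrf}\,(e_1\parallel e_2)\,(\lambda v.\,Q_1\,v.1 * Q_2\,v.2)\,s$; - ($\mathsf{vrf\_frame}$) $(\mathsf{vrf}\,e\,Q_1 * Q_2^\circ)\,s\to\mathsf{vrf}\,e\,(\lambda v.\,Q_1\,v * Q_2)\,s$; - ($\mathsf{vrf\_act}$) $(\lambda s'.\,\exists s''\,v.\ [a]\,s'=(s'',v)\wedge(Q\,v)^\circ s'')^\circ s\to\mathsf{vrf}\,\langle a\rangle\,Q\,s$; - ($\mathsf{vrf\_morph}$) $\hat f(\mathsf{vrf}\,e\,Q)\,s_w\to I\,s_w\to\mathsf{vrf}\,(\mathsf{morph}\,f\,e)\,(\lambda v\,s_w'.\ \hat f(Q\,v)\,s_w'\wedge I\,s_w')\,s_w$; and for an indexed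 family $f$ over $X$, $x\in X$ and an $f$-simulation $I$: $\hat f_x(\mathsf{vrf}\,e\,Q)\,s_w\to I\,x\,s_w\to\mathsf{vrf}\,(\mathsf{morph}\,f\,x\,e)\,(\lambda v\,s_w'.\ \exists y.\ \hat f_y(Q\,v)\,s_w'\wedge I\,y\,s_w')\,s_w$; - ($\mathsf{Morph}$) if $e\in[\Gamma].\{P\}A\{Q\}@V$ and each $I_\gamma$ is an $f$-simulation, then $\mathsf{morph}\,f\,e\in[\Gamma].\{\hat f P_\gamma\wedge I_\gamma\}A\{\lambda v.\,\hat f(Q_\gamma\,v)\wedge I_\gamma\}@W$; ($\mathsf{MorphX}$) likewise, for families, $\mathsf{morph}\,f\,x\,e\in[\Gamma].\{\hat f_xP_\gamma\wedge I_\gamma\,x\}A\{\lambda v\,s_w.\,\exists y.\ \hat f_y(Q_\gamma\,v)\,s_w\wedge I_\gamma\,y\,s_w\}@W$; - ($\mathsf{Fix}$) if $T=\Pi_{x:A}.\,[\Gamma].\{P\}B\{Q\}@V$ (where $\Gamma,P,B,Q$ may depend on $x$) and $F:T\to T$, then $\mathsf{fix}\,F\in T$. -/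

import Mathlib

universe u w

namespace Morphing

/-! ### Partial commutative monoids, subjective states, heaps -/

/-- A partial commutative monoid. `join x y = none` means that the join of `x` and `y` is undefined. -/
class PCM (M : Type u) where
  join : M → M → Option M
  one : M
  join_comm : ∀ x y, join x y = join y x
  join_assoc : ∀ x y z, ((join x y).bind fun a => join a z) = (join y z).bind fun b => join x b
  one_join : ∀ x, join one x = some x

/-- An `(M, T)`-state: the *self*, *joint* and *other* components. -/
@[ext]
structure SState (M T : Type u) where
  self : M
  joint : T
  other : M

namespace SState

variable {M T : Type u} [PCM M]

/-- `s ⊲ p`: join the frame `p` to *self*; undefined if the join is. -/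
def selfFrame (s : SState M T) (p : M) : Option (SState M T) :=
  (PCM.join s.self p).map fun a => ⟨a, s.joint, s.other⟩

/-- `s ⊳ p`: join the frame `p` to *other*; undefined if the join is. -/
def otherFrame (s : SState M T) (p : M) : Option (SState M T) :=
  (PCM.join p s.other).map fun a => ⟨s.self, s.joint, a⟩

/-- Transposition: the view of the *other* threads. -/
def transpose (s : SState M T) : SState M T := ⟨s.other, s.joint, s.self⟩

/-- `s = s₁ * s₂`: a parent state `s = (a₁ • a₂, j, a₃)` splits into the states
`s₁ = (a₁, j, a₂ • a₃)` and `s₂ = (a₂, j, a₃ • a₁)` of its two children. -/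
def Split (s s₁ s₂ : SState M T) : Prop :=
  s₁.joint = s.joint ∧ s₂.joint = s.joint ∧
  PCM.join s₁.self s₂.self = some s.self ∧
  PCM.join s₂.self s.other = some s₁.other ∧
  PCM.join s.other s₁.self = some s₂.other

/-- A predicate is global if it cannot distinguish `s ⊳ p` from `s ⊲ p` (when both are defined). -/
def GlobalPred (P : SState M T → Prop) : Prop :=
  ∀ (s : SState M T) (p : M) (sl sr : SState M T),
    s.selfFrame p = some sl → s.otherFrame p = some sr → (P sr ↔ P sl)

/-- A partial function `g` is global under the predicate `P`. -/
def GlobalFunUnder {H : Type u} (P : SState M T → Prop) (g : SState M T → Option H) : Prop :=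
  ∀ (s : SState M T) (p : M) (sl sr : SState M T),
    s.selfFrame p = some sl → s.otherFrame p = some sr → P sl → g sr = g sl

end SState

/-- Heaps: finite partial maps from (non-null) pointers to values. -/
structure Heap (Loc Val : Type u) where
  get : Loc → Option Val
  finite_dom : {l | (get l).isSome}.Finite

/-- The set of pointers of a heap. -/
def Heap.dom {Loc Val : Type u} (h : Heap Loc Val) : Set Loc := {l | (h.get l).isSome}

/-! ### Resources -/

/-- A state space: a global predicate and an erasure into heaps that is global under it. -/
structure StateSpace (Loc Val M T : Type u) [PCM M] where
  mem : SState M T → Prop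
  erase : SState M T → Option (Heap Loc Val)
  mem_global : SState.GlobalPred mem
  erase_global : SState.GlobalFunUnder mem erase
  compat : ∀ s, mem s → (PCM.join s.self s.other).isSome
  erase_defined : ∀ s, mem s → (erase s).isSome

/-- The states that belong to a state space. -/
abbrev StateSpace.St {Loc Val M T : Type u} [PCM M] (S : StateSpace Loc Val M T) : Type u :=
  {s : SState M T // S.mem s}

/-- Transitions over a state space. -/
structure IsTransition {Loc Val M T : Type u} [PCM M] (S : StateSpace Loc Val M T)
    (t : S.St → S.St → Prop) : Prop where
  functional : ∀ s s₁ s₂, t s s₁ → t s s₂ → s₁ = s₂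
  other_fixed : ∀ s s', t s s' → s.1.other = s'.1.other
  locality : ∀ (s : SState M T) (p : M) (sl sr x : S.St),
    s.selfFrame p = some sl.1 → s.otherFrame p = some sr.1 → t sr x →
      ∃ (s' : SState M T) (sl' : S.St),
        s'.otherFrame p = some x.1 ∧ s'.selfFrame p = some sl'.1 ∧ t sl sl'

/-- Footprint preservation: the pre- and the post-state erase to heaps with the same pointers. -/
def FootprintPreserving {Loc Val M T : Type u} [PCM M] (S : StateSpace Loc Val M T)
    (t : S.St → S.St → Prop) : Prop :=
  ∀ s s', t s s' → ∀ h h', S.erase s.1 = some h → S.erase s'.1 = some h' → h.dom = h'.dom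

/-- A resource `(M, T, Σ, Δ)`. -/
structure Resource (Loc Val : Type u) : Type (u + 1) where
  M : Type u
  T : Type u
  [pcm : PCM M]
  space : StateSpace Loc Val M T
  trans : Set (space.St → space.St → Prop)
  isTransition : ∀ t ∈ trans, IsTransition space t
  footprint : ∀ t ∈ trans, FootprintPreserving space t

attribute [instance] Resource.pcm

variable {Loc Val : Type u}

namespace Resource

/-- `V`-states. -/
abbrev St (V : Resource Loc Val) : Type u := V.space.St

/-- The transitions of `V`, as a type. -/
abbrev Tr (V : Resource Loc Val) : Type u := {t : V.St → V.St → Prop // t ∈ V.trans}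

/-- `s` other-steps to `s'` by `V`: some transition of `V` goes from the transpose of `s` to the
transpose of `s'`. -/
def OStep (V : Resource Loc Val) (s s' : V.St) : Prop :=
  ∃ (t : V.Tr) (r r' : V.St), r.1 = s.1.transpose ∧ r'.1 = s'.1.transpose ∧ t.1 r r'

/-- Any number of other-steps. -/
def OSteps (V : Resource Loc Val) : V.St → V.St → Prop := Relation.ReflTransGen V.OStep

/-- Stabilization of a predicate under interference. -/
def stab (V : Resource Loc Val) (Q : V.St → Prop) (s : V.St) : Prop :=
  ∀ s', V.OSteps s s' → Q s'

/-- Subjective separating conjunction. -/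
def sep (V : Resource Loc Val) (P Q : V.St → Prop) (s : V.St) : Prop :=
  ∃ s₁ s₂ : V.St, SState.Split s.1 s₁.1 s₂.1 ∧ P s₁ ∧ Q s₂

end Resource

/-- An action of type `A` in `V`: a local partial function from `V`-states to a transition of `V`
and a value. -/
structure Action (V : Resource Loc Val) (A : Type u) where
  run : V.St → Option (V.Tr × A)
  locality : ∀ (s : SState V.M V.T) (p : V.M) (sl sr : V.St) (t : V.Tr) (v : A),
    s.selfFrame p = some sl.1 → s.otherFrame p = some sr.1 →
      run sr = some (t, v) → run sl = some (t, v)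

/-- The effect of an action: `a.Effect s s' v` means `[a] s = (s', v)`. -/
def Action.Effect {V : Resource Loc Val} {A : Type u} (a : Action V A) (s s' : V.St) (v : A) :
    Prop :=
  ∃ t : V.Tr, a.run s = some (t, v) ∧ t.1 s s'

/-! ### Morphisms and simulations -/

/-- Resource morphisms `f : V → W`. -/
structure Morphism (V W : Resource Loc Val) where
  onState : W.St → Option V.St
  onTrans : W.St → V.Tr → Option W.Tr
  state_locality : ∃ φ : W.M → V.M, ∀ (s : SState W.M W.T) (p : W.M) (sl sr : W.St) (sv : V.St),
    s.selfFrame p = some sl.1 → s.otherFrame p = some sr.1 → onState sr = some sv →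
      ∃ (sv' : SState V.M V.T) (svl : V.St),
        sv'.otherFrame (φ p) = some sv.1 ∧ sv'.selfFrame (φ p) = some svl.1 ∧
          onState sl = some svl
  trans_locality : ∀ (s : SState W.M W.T) (p : W.M) (sl sr : W.St) (tv : V.Tr) (tw : W.Tr),
    s.selfFrame p = some sl.1 → s.otherFrame p = some sr.1 →
      onTrans sr tv = some tw → onTrans sl tv = some tw
  other_fixed : ∀ (s s' : W.St) (sv sv' : V.St), s.1.other = s'.1.other →
    onState s = some sv → onState s' = some sv' → sv.1.other = sv'.1.other

/-- Indexed families of morphisms from `V` to `W` over the index type `X`. -/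
structure Family (V W : Resource Loc Val) (X : Type u) where
  onState : X → W.St → Option V.St
  onTrans : X → W.St → V.Tr → Option W.Tr
  state_locality : ∃ φ : W.M → V.M,
    ∀ (x : X) (s : SState W.M W.T) (p : W.M) (sl sr : W.St) (sv : V.St),
    s.selfFrame p = some sl.1 → s.otherFrame p = some sr.1 → onState x sr = some sv →
      ∃ (sv' : SState V.M V.T) (svl : V.St),
        sv'.otherFrame (φ p) = some sv.1 ∧ sv'.selfFrame (φ p) = some svl.1 ∧
          onState x sl = some svl
  trans_locality : ∀ (x : X) (s : SState W.M W.T) (p : W.M) (sl sr : W.St) (tv : V.Tr) (tw : W.Tr),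
    s.selfFrame p = some sl.1 → s.otherFrame p = some sr.1 →
      onTrans x sr tv = some tw → onTrans x sl tv = some tw
  other_fixed : ∀ (x x' : X) (s s' : W.St) (sv sv' : V.St), s.1.other = s'.1.other →
    onState x s = some sv → onState x' s' = some sv' → sv.1.other = sv'.1.other
  index_injective : ∀ (x₁ x₂ : X) (s₁ s₂ : W.St) (sv : V.St),
    onState x₁ s₁ = some sv → onState x₂ s₂ = some sv → x₁ = x₂

/-- A morphism is a family over the one-point type. -/
def Morphism.toFamily {V W : Resource Loc Val} (f : Morphism V W) : Family V W PUnit.{u + 1} where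
  onState _ := f.onState
  onTrans _ := f.onTrans
  state_locality := f.state_locality.imp fun _ h _ => h
  trans_locality _ := f.trans_locality
  other_fixed _ _ := f.other_fixed
  index_injective _ _ _ _ _ _ _ := rfl

/-- The identity morphism. -/
def Morphism.id (V : Resource Loc Val) : Morphism V V where
  onState s := some s
  onTrans _ t := some t
  state_locality := ⟨fun p => p, fun s p sl sr sv hl hr h => by
    cases h; exact ⟨s, sl, hr, hl, rfl⟩⟩
  trans_locality _ _ _ _ _ _ _ _ h := h
  other_fixed s s' sv sv' h h₁ h₂ := by cases h₁; cases h₂; exact h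

/-- `f`-simulations, for a morphism `f`. -/
structure Morphism.IsSimulation {V W : Resource Loc Val} (f : Morphism V W) (I : W.St → Prop) :
    Prop where
  forward : ∀ (sw : W.St) (sv sv' : V.St) (tv : V.Tr),
    I sw → f.onState sw = some sv → tv.1 sv sv' →
      ∃ (tw : W.Tr) (sw' : W.St),
        f.onTrans sw tv = some tw ∧ I sw' ∧ f.onState sw' = some sv' ∧ tw.1 sw sw'
  backward : ∀ (sw sw' : W.St) (sv : V.St),
    I sw → f.onState sw = some sv → W.OSteps sw sw' →
      I sw' ∧ ∃ sv', f.onState sw' = some sv' ∧ V.OSteps sv sv'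

/-- `f`-simulations, for an indexed family `f`. -/
structure Family.IsSimulation {V W : Resource Loc Val} {X : Type u} (f : Family V W X)
    (I : X → W.St → Prop) : Prop where
  forward : ∀ (x : X) (sw : W.St) (sv sv' : V.St) (tv : V.Tr),
    I x sw → f.onState x sw = some sv → tv.1 sv sv' →
      ∃ (x' : X) (tw : W.Tr) (sw' : W.St),
        f.onTrans x sw tv = some tw ∧ I x' sw' ∧ f.onState x' sw' = some sv' ∧ tw.1 sw sw'
  backward : ∀ (x : X) (sw sw' : W.St) (sv : V.St),
    I x sw → f.onState x sw = some sv → W.OSteps sw sw' →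
      I x sw' ∧ ∃ sv', f.onState x sw' = some sv' ∧ V.OSteps sv sv'

/-- Invariants of `V`: simulations for the identity morphism. -/
def IsInvariant (V : Resource Loc Val) (J : V.St → Prop) : Prop :=
  (Morphism.id V).IsSimulation J

/-- Lifting of a predicate along a morphism. -/
def Morphism.lift {V W : Resource Loc Val} (f : Morphism V W) (R : V.St → Prop) (sw : W.St) :
    Prop :=
  ∃ sv, f.onState sw = some sv ∧ R sv

/-- Lifting of a predicate along a member of a family. -/
def Family.lift {V W : Resource Loc Val} {X : Type u} (f : Family V W X) (x : X)
    (R : V.St → Prop) (sw : W.St) : Prop :=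
  ∃ sv, f.onState x sw = some sv ∧ R sv

/-! ### Action trees and their operational semantics -/

/-- Action trees: finite partial approximations of the behaviour of a program in `V` that returns
values of type `A`. `unfinished` marks the point where the approximation is cut off. -/
inductive Tree : Resource.{u} Loc Val → Type u → Type (u + 1)
  | unfinished {V : Resource Loc Val} {A : Type u} : Tree V A
  | ret {V : Resource Loc Val} {A : Type u} (v : A) : Tree V A
  | act {V : Resource Loc Val} {A : Type u} (a : Action V A) : Tree V A
  | seq {V : Resource Loc Val} {A B : Type u} (t : Tree V B) (k : B → Tree V A) : Tree V A
  | par {V : Resource Loc Val} {A B₁ B₂ : Type u} (t₁ : Tree V B₁) (t₂ : Tree V B₂)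
      (k : B₁ × B₂ → Tree V A) : Tree V A
  | morph {V W : Resource Loc Val} {A X : Type u} (f : Family V W X) (x : X) (t : Tree V A) :
      Tree W A

/-- Paths, which select the redex of a tree that is to be reduced. -/
inductive Path : Type
  | act
  | seqRet
  | seqStep (π : Path)
  | parRet
  | parL (π : Path)
  | parR (π : Path)
  | morphRet
  | morphStep (π : Path)

/-- `Redex π t`: the path `π` leads to a redex of the tree `t`. -/
inductive Redex : {V : Resource.{u} Loc Val} → {A : Type u} → Path → Tree V A → Prop
  | act {V : Resource Loc Val} {A : Type u} (a : Action V A) : Redex .act (.act a)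
  | seqRet {V : Resource Loc Val} {A B : Type u} (v : B) (k : B → Tree V A) :
      Redex .seqRet (.seq (.ret v) k)
  | seqStep {V : Resource Loc Val} {A B : Type u} {π : Path} {t : Tree V B} (k : B → Tree V A) :
      Redex π t → Redex (.seqStep π) (.seq t k)
  | parRet {V : Resource Loc Val} {A B₁ B₂ : Type u} (v₁ : B₁) (v₂ : B₂)
      (k : B₁ × B₂ → Tree V A) : Redex .parRet (.par (.ret v₁) (.ret v₂) k)
  | parL {V : Resource Loc Val} {A B₁ B₂ : Type u} {π : Path} {t₁ : Tree V B₁} (t₂ : Tree V B₂)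
      (k : B₁ × B₂ → Tree V A) : Redex π t₁ → Redex (.parL π) (.par t₁ t₂ k)
  | parR {V : Resource Loc Val} {A B₁ B₂ : Type u} {π : Path} (t₁ : Tree V B₁) {t₂ : Tree V B₂}
      (k : B₁ × B₂ → Tree V A) : Redex π t₂ → Redex (.parR π) (.par t₁ t₂ k)
  | morphRet {V W : Resource Loc Val} {A X : Type u} (f : Family V W X) (x : X) (v : A) :
      Redex .morphRet (.morph f x (.ret v))
  | morphStep {V W : Resource Loc Val} {A X : Type u} {π : Path} (f : Family V W X) (x : X)
      {t : Tree V A} : Redex π t → Redex (.morphStep π) (.morph f x t)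

/-- Labels of reductions: a reduction is either silent (and leaves the state alone), or it takes
a transition of the resource between two given states. -/
inductive Label (V : Resource Loc Val) : Type u
  | tau
  | move (s : V.St) (t : V.Tr) (s' : V.St)

/-- Reduction of a tree at a path. In `morphMove`, the morphed program determines the `V`-state
`sv` of the current `W`-state `sw`, lets the body choose the `V`-transition `tv` from `sv` to `sv'`,
and takes the corresponding `W`-transition; the new index is the one that relates the new states. -/
inductive Step : {V : Resource.{u} Loc Val} → {A : Type u} →
    Path → Tree V A → Label V → Tree V A → Prop
  | act {V : Resource Loc Val} {A : Type u} (a : Action V A) (s s' : V.St) (t : V.Tr) (v : A) :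
      a.run s = some (t, v) → t.1 s s' → Step .act (.act a) (.move s t s') (.ret v)
  | seqRet {V : Resource Loc Val} {A B : Type u} (v : B) (k : B → Tree V A) :
      Step .seqRet (.seq (.ret v) k) .tau (k v)
  | seqStep {V : Resource Loc Val} {A B : Type u} {π : Path} {t t' : Tree V B} {l : Label V}
      (k : B → Tree V A) : Step π t l t' → Step (.seqStep π) (.seq t k) l (.seq t' k)
  | parRet {V : Resource Loc Val} {A B₁ B₂ : Type u} (v₁ : B₁) (v₂ : B₂)
      (k : B₁ × B₂ → Tree V A) :
      Step .parRet (.par (.ret v₁) (.ret v₂) k) .tau (k (v₁, v₂))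
  | parL {V : Resource Loc Val} {A B₁ B₂ : Type u} {π : Path} {t₁ t₁' : Tree V B₁} {l : Label V}
      (t₂ : Tree V B₂) (k : B₁ × B₂ → Tree V A) :
      Step π t₁ l t₁' → Step (.parL π) (.par t₁ t₂ k) l (.par t₁' t₂ k)
  | parR {V : Resource Loc Val} {A B₁ B₂ : Type u} {π : Path} {t₂ t₂' : Tree V B₂} {l : Label V}
      (t₁ : Tree V B₁) (k : B₁ × B₂ → Tree V A) :
      Step π t₂ l t₂' → Step (.parR π) (.par t₁ t₂ k) l (.par t₁ t₂' k)
  | morphRet {V W : Resource Loc Val} {A X : Type u} (f : Family V W X) (x : X) (v : A) :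
      Step .morphRet (.morph f x (.ret v)) .tau (.ret v)
  | morphTau {V W : Resource Loc Val} {A X : Type u} {π : Path} {t t' : Tree V A}
      (f : Family V W X) (x : X) :
      Step π t .tau t' → Step (.morphStep π) (.morph f x t) .tau (.morph f x t')
  | morphMove {V W : Resource Loc Val} {A X : Type u} {π : Path} {t t' : Tree V A}
      (f : Family V W X) (x x' : X) (sw sw' : W.St) (sv sv' : V.St) (tv : V.Tr) (tw : W.Tr) :
      f.onState x sw = some sv → Step π t (.move sv tv sv') t' → f.onTrans x sw tv = some tw →
      tw.1 sw sw' → f.onState x' sw' = some sv' →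
      Step (.morphStep π) (.morph f x t) (.move sw tw sw') (.morph f x' t')

/-- Reduction of a configuration (state and tree) at a path. -/
def Red {V : Resource Loc Val} {A : Type u} (π : Path) (s : V.St) (t : Tree V A) (s' : V.St)
    (t' : Tree V A) : Prop :=
  (Step π t .tau t' ∧ s' = s) ∨ ∃ tr : V.Tr, Step π t (.move s tr s') t'

/-- One step of a configuration: interference by the environment or a reduction of the tree. -/
inductive CfgStep {V : Resource Loc Val} {A : Type u} :
    V.St × Tree V A → V.St × Tree V A → Prop
  | env (s s' : V.St) (t : Tree V A) : V.OStep s s' → CfgStep (s, t) (s', t)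
  | prog (π : Path) (s s' : V.St) (t t' : Tree V A) : Red π s t s' t' → CfgStep (s, t) (s', t')

/-- No redex of `t` is stuck in the state `s`. -/
def Safe {V : Resource Loc Val} {A : Type u} (s : V.St) (t : Tree V A) : Prop :=
  ∀ π, Redex π t → ∃ s' t', Red π s t s' t'

/-- Every configuration reachable from `(s, t)` under interference is safe, and satisfies `Q` if
the tree has returned a value. -/
def After {V : Resource Loc Val} {A : Type u} (s : V.St) (t : Tree V A) (Q : A → V.St → Prop) :
    Prop :=
  ∀ s' t', Relation.ReflTransGen CfgStep (s, t) (s', t') →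
    Safe s' t' ∧ ∀ v, t' = .ret v → Q v s'

/-! ### Programs, the predicate transformer, and Hoare types -/

/-- Programs over `V` with results in `A`: sets of action trees that contain `unfinished`. -/
def ST (V : Resource.{u} Loc Val) (A : Type u) : Type (u + 1) :=
  {S : Set (Tree V A) // Tree.unfinished ∈ S}

namespace ST

/-- Approximation order: inclusion. -/
instance {V : Resource Loc Val} {A : Type u} : PartialOrder (ST V A) :=
  inferInstanceAs (PartialOrder {S : Set (Tree V A) // Tree.unfinished ∈ S})

/-- The idle program returning `v`. -/
def ret {V : Resource Loc Val} {A : Type u} (v : A) : ST V A :=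
  ⟨{t | t = .unfinished ∨ t = .ret v}, Or.inl rfl⟩

/-- The program executing the action `a`. -/
def act {V : Resource Loc Val} {A : Type u} (a : Action V A) : ST V A :=
  ⟨{t | t = .unfinished ∨ t = .act a}, Or.inl rfl⟩

/-- Sequential composition. -/
def bnd {V : Resource Loc Val} {A B : Type u} (e₁ : ST V B) (e₂ : B → ST V A) : ST V A :=
  ⟨{t | t = .unfinished ∨ ∃ t₁ k, t₁ ∈ e₁.1 ∧ (∀ x, k x ∈ (e₂ x).1) ∧ t = .seq t₁ k}, Or.inl rfl⟩

/-- Parallel composition. -/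
def par {V : Resource Loc Val} {A₁ A₂ : Type u} (e₁ : ST V A₁) (e₂ : ST V A₂) : ST V (A₁ × A₂) :=
  ⟨{t | t = .unfinished ∨ ∃ t₁ t₂, t₁ ∈ e₁.1 ∧ t₂ ∈ e₂.1 ∧ t = .par t₁ t₂ .ret}, Or.inl rfl⟩

/-- Action of an indexed family, with initial index `x`, on a program. -/
def morphX {V W : Resource Loc Val} {A X : Type u} (f : Family V W X) (x : X) (e : ST V A) :
    ST W A :=
  ⟨{t | t = .unfinished ∨ ∃ t₁, t₁ ∈ e.1 ∧ t = .morph f x t₁}, Or.inl rfl⟩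

/-- Action of a morphism on a program. -/
def morph {V W : Resource Loc Val} {A : Type u} (f : Morphism V W) (e : ST V A) : ST W A :=
  morphX f.toFamily PUnit.unit e

/-- The fixed-point combinator on a set `T` of (dependent) functions into programs. The function
`F : T → T` need not be monotone, so `fix F` is the least fixed point of its monotone completion
`e ↦ ⨆ (e' ∈ T, e' ≤ e), F e'`, given as the infimum of the pre-fixed points. -/
def fix {V : Resource Loc Val} {A : Type u} {B : A → Type u} {T : Set (∀ x, ST V (B x))}
    (F : T → T) : ∀ x, ST V (B x) := fun x =>
  ⟨{t | ∀ e : ∀ x, ST V (B x), (∀ e' : T, e'.1 ≤ e → (F e').1 ≤ e) → t ∈ (e x).1},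
    fun e _ => (e x).2⟩

end ST

/-- `vrf e Q`: the `V`-states from which `e` is safe to run and every result `v` and final state
`s'` satisfy `Q v s'`. -/
def vrf {V : Resource Loc Val} {A : Type u} (e : ST V A) (Q : A → V.St → Prop) (s : V.St) : Prop :=
  ∀ t ∈ e.1, After s t Q

/-- The Hoare type `[Γ]. {P} A {Q} @ V`, as a set of programs. -/
def Hoare {V : Resource Loc Val} {A : Type u} {Γ : Type w} (P : Γ → V.St → Prop)
    (Q : Γ → A → V.St → Prop) : Set (ST V A) :=
  {e | ∀ (γ : Γ) (s : V.St), P γ s → vrf e (Q γ) s}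

end Morphing

namespace Morphing

variable {Loc Val : Type u}

/-! ### Frames and splittings -/

namespace SState

variable {M T : Type u} [PCM M]

/-! `After s t Q` is a greatest fixed point: it holds as soon as some relation between states and
trees contains `(s, t)`, implies safety and the postcondition, and is closed under other-steps and
reductions (`After.of_invariant`). Each structural rule is proved by choosing such a relation;
applying `After` to every tree of a program then gives the statement about `vrf`.

The rules for parallel composition and framing need a way to follow a split `s = s₁ * s₂` through
execution. Parent and left child are the two framings of one smaller state, and the left child and
the transposed right child are again the two framings of one state. Applying locality of a
transition to both pairs shows that a move of one child is the same move of the parent and an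
other-step of the sibling (`Tr.split`). Dually, an other-step of the parent is an other-step of both
children (`OStep.split`). `Step.locality` lifts locality from transitions to reductions of whole
trees, including morphed ones. A reduction observed in the parent must then be traced back to a
child: safety supplies some reduction of the child at that path, and determinism forces it to be the
observed one (`Red.deterministic`, `Red.of_split`).

For morphisms, the relation keeps the simulation and the related state of the source resource. The
forward clause gives progress, and determinism of transitions and injectivity of indices identify
its witness with the step actually taken. The backward clause absorbs interference. Fixed points
need no induction, because a Hoare type constrains each tree separately and so has a largest member.
-/

theorem selfFrame_eq_some {s x : SState M T} {p : M} :
    s.selfFrame p = some x ↔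
      PCM.join s.self p = some x.self ∧ x.joint = s.joint ∧ x.other = s.other := by
  rw [selfFrame, Option.map_eq_some_iff]
  constructor
  · rintro ⟨a, h, rfl⟩
    exact ⟨h, rfl, rfl⟩
  · rintro ⟨h, hj, ho⟩
    exact ⟨_, h, SState.ext rfl hj.symm ho.symm⟩

theorem otherFrame_eq_some {s x : SState M T} {p : M} :
    s.otherFrame p = some x ↔
      PCM.join p s.other = some x.other ∧ x.joint = s.joint ∧ x.self = s.self := by
  rw [otherFrame, Option.map_eq_some_iff]
  constructor
  · rintro ⟨a, h, rfl⟩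
    exact ⟨h, rfl, rfl⟩
  · rintro ⟨h, hj, ho⟩
    exact ⟨_, h, SState.ext ho.symm hj.symm rfl⟩

/-- Join need not be cancellative, so equality of the framed states does not by itself determine
*other*; agreement there is an extra hypothesis. -/
theorem otherFrame_injective {s₁ s₂ x : SState M T} {p : M} (h₁ : s₁.otherFrame p = some x)
    (h₂ : s₂.otherFrame p = some x) (ho : s₁.other = s₂.other) : s₁ = s₂ := by
  obtain ⟨_, hj₁, hs₁⟩ := otherFrame_eq_some.1 h₁
  obtain ⟨_, hj₂, hs₂⟩ := otherFrame_eq_some.1 h₂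
  exact SState.ext (hs₁.symm.trans hs₂) (hj₁.symm.trans hj₂) ho

theorem Split.symm {s s₁ s₂ : SState M T} (h : Split s s₁ s₂) : Split s s₂ s₁ := by
  obtain ⟨h₁, h₂, h₃, h₄, h₅⟩ := h
  exact ⟨h₂, h₁, by rwa [PCM.join_comm], by rwa [PCM.join_comm], by rwa [PCM.join_comm]⟩

/-- The parent and its left child are the two framings of one state by *self* of the right child. -/
theorem Split.frames {s s₁ s₂ : SState M T} (h : Split s s₁ s₂) :
    (⟨s₁.self, s.joint, s.other⟩ : SState M T).selfFrame s₂.self = some s ∧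
      (⟨s₁.self, s.joint, s.other⟩ : SState M T).otherFrame s₂.self = some s₁ :=
  ⟨selfFrame_eq_some.2 ⟨h.2.2.1, rfl, rfl⟩, otherFrame_eq_some.2 ⟨h.2.2.2.1, h.1, rfl⟩⟩

/-- The transposes of the parent and of its left child are the two framings of one state. -/
theorem Split.frames_transpose {s s₁ s₂ : SState M T} (h : Split s s₁ s₂) :
    (⟨s.other, s.joint, s₁.self⟩ : SState M T).selfFrame s₂.self = some s₁.transpose ∧
      (⟨s.other, s.joint, s₁.self⟩ : SState M T).otherFrame s₂.self = some s.transpose :=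
  ⟨selfFrame_eq_some.2 ⟨(PCM.join_comm _ _).trans h.2.2.2.1, h.1, rfl⟩,
    otherFrame_eq_some.2 ⟨(PCM.join_comm _ _).trans h.2.2.1, rfl, rfl⟩⟩

/-- The transpose of the right child and the left child are the two framings of one state by
*other* of the parent. -/
theorem Split.frames_children {s s₁ s₂ : SState M T} (h : Split s s₁ s₂) :
    (⟨s₁.self, s.joint, s₂.self⟩ : SState M T).selfFrame s.other = some s₂.transpose ∧
      (⟨s₁.self, s.joint, s₂.self⟩ : SState M T).otherFrame s.other = some s₁ :=
  ⟨selfFrame_eq_some.2 ⟨(PCM.join_comm _ _).trans h.2.2.2.2, h.2.1, rfl⟩,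
    otherFrame_eq_some.2 ⟨(PCM.join_comm _ _).trans h.2.2.2.1, h.1, rfl⟩⟩

end SState

open SState

/-! ### Transitions and other-steps across a split -/

namespace Resource

variable {V : Resource Loc Val}

theorem mem_of_split {s s₁ s₂ : SState V.M V.T} (h : Split s s₁ s₂) (hs : V.space.mem s) :
    V.space.mem s₁ :=
  (V.space.mem_global _ _ _ _ h.frames.1 h.frames.2).2 hs

/-- A transition of the left child is one of the parent, and an other-step of the right child. -/
theorem Tr.split {s s₁ s₂ s₁' : V.St} (t : V.Tr) (h : Split s.1 s₁.1 s₂.1) (ht : t.1 s₁ s₁') :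
    ∃ s' s₂' : V.St, t.1 s s' ∧ Split s'.1 s₁'.1 s₂'.1 ∧ V.OStep s₂ s₂' := by
  have loc := V.isTransition t.1 t.2
  obtain ⟨u, s', hu₁, hu₂, hs'⟩ := loc.locality _ _ _ _ _ h.frames.1 h.frames.2 ht
  -- The transposed right child lies in the state space because it and `s₁` are the two framings of
  -- one state by the parent's *other*.
  let r : V.St := ⟨s₂.1.transpose,
    (V.space.mem_global _ _ _ _ h.frames_children.1 h.frames_children.2).1 s₁.2⟩
  obtain ⟨c, r', hc₁, hc₂, hr'⟩ :=
    loc.locality _ _ r _ _ h.frames_children.1 h.frames_children.2 ht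
  rw [otherFrame_eq_some] at hu₁ hc₁
  rw [selfFrame_eq_some] at hu₂ hc₂
  have ho : s.1.other = s'.1.other := loc.other_fixed _ _ hs'
  have hr : s₂.1.self = r'.1.other := loc.other_fixed _ _ hr'
  -- The two uses of locality supply the new parent and the transposed new right child; preservation
  -- of *other* keeps `s.other` and `s₂.self` unchanged, which makes the pieces fit together.
  have key : Split s'.1 s₁'.1 r'.1.transpose := by
    refine ⟨hu₁.2.1.trans hu₂.2.1.symm, ?_, ?_, ?_, ?_⟩
    · exact hc₂.2.1.trans (hc₁.2.1.symm.trans (hu₁.2.1.trans hu₂.2.1.symm))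
    · change PCM.join _ r'.1.other = _
      rw [← hr, hu₁.2.2]
      exact hu₂.1
    · change PCM.join r'.1.other _ = _
      rw [← hr, hu₂.2.2]
      exact hu₁.1
    · change _ = some r'.1.self
      rw [← ho, PCM.join_comm, hc₁.2.2]
      exact hc₂.1
  exact ⟨s', ⟨_, mem_of_split key.symm s'.2⟩, hs', key, t, r, r', rfl, rfl, hr'⟩

theorem OStep.self_eq {s s' : V.St} (h : V.OStep s s') : s.1.self = s'.1.self := by
  obtain ⟨t, r, r', hr, hr', ht⟩ := h
  have := (V.isTransition t.1 t.2).other_fixed _ _ ht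
  rwa [hr, hr'] at this

/-- An other-step of the parent is an other-step of its left child. -/
theorem OStep.split_left {s s' s₁ : V.St} {s₂ : SState V.M V.T} (h : Split s.1 s₁.1 s₂)
    (hs : V.OStep s s') :
    ∃ s₁' : V.St, V.OStep s₁ s₁' ∧ s₁'.1.joint = s'.1.joint ∧
      PCM.join s₂.self s'.1.other = some s₁'.1.other := by
  have hself := hs.self_eq
  obtain ⟨t, r, r', hr, hr', ht⟩ := hs
  have loc := V.isTransition t.1 t.2
  obtain ⟨hf₁, hf₂⟩ := h.frames_transpose
  rw [← hr] at hf₂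
  let q : V.St := ⟨s₁.1.transpose, (V.space.mem_global _ _ _ _ hf₁ hf₂).1 r.2⟩
  obtain ⟨u, q', hu₁, hu₂, hq'⟩ := loc.locality _ _ q _ _ hf₁ hf₂ ht
  rw [otherFrame_eq_some, hr'] at hu₁
  rw [selfFrame_eq_some] at hu₂
  have hq : s₁.1.self = q'.1.other := loc.other_fixed _ _ hq'
  have hj : q'.1.joint = s'.1.joint := hu₂.2.1.trans hu₁.2.1.symm
  have ho : PCM.join s₂.self s'.1.other = some q'.1.self := by
    rw [PCM.join_comm, show s'.1.other = u.self from hu₁.2.2]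
    exact hu₂.1
  -- Locality only places `q'` itself in the state space. Its transpose and `s'` are the two
  -- framings of one state by `s₂.self`, so globality transfers membership from `s'`.
  have hmem : V.space.mem q'.1.transpose := by
    refine (V.space.mem_global ⟨s₁.1.self, s'.1.joint, s'.1.other⟩ s₂.self s'.1 _ ?_ ?_).2 s'.2
    · exact selfFrame_eq_some.2 ⟨hself ▸ h.2.2.1, rfl, rfl⟩
    · exact otherFrame_eq_some.2 ⟨ho, hj, hq.symm⟩
  exact ⟨⟨_, hmem⟩, ⟨t, q, q', rfl, rfl, hq'⟩, hj, ho⟩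

/-- An other-step of the parent is an other-step of both children. -/
theorem OStep.split {s s' s₁ s₂ : V.St} (h : Split s.1 s₁.1 s₂.1) (hs : V.OStep s s') :
    ∃ s₁' s₂' : V.St, Split s'.1 s₁'.1 s₂'.1 ∧ V.OStep s₁ s₁' ∧ V.OStep s₂ s₂' := by
  obtain ⟨s₁', h₁, hj₁, ho₁⟩ := hs.split_left h
  obtain ⟨s₂', h₂, hj₂, ho₂⟩ := hs.split_left h.symm
  refine ⟨s₁', s₂', ⟨hj₁, hj₂, ?_, ?_, ?_⟩, h₁, h₂⟩
  · rw [← h₁.self_eq, ← h₂.self_eq, ← hs.self_eq]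
    exact h.2.2.1
  · rw [← h₂.self_eq]
    exact ho₁
  · rw [← h₁.self_eq, PCM.join_comm]
    exact ho₂

end Resource

/-! ### Reductions: transitions, redexes, determinism, locality -/

section Step

variable {V : Resource Loc Val} {A : Type u}

theorem Step.trans {π : Path} {t t' : Tree V A} {s s' : V.St} {tr : V.Tr}
    (h : Step π t (.move s tr s') t') : tr.1 s s' := by
  generalize hl : Label.move s tr s' = l at h
  induction h with
  | act a r r' tr' v hr ht => cases hl; exact ht
  | seqRet => cases hl
  | seqStep k h ih => exact ih hl
  | parRet => cases hl
  | parL t₂ k h ih => exact ih hl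
  | parR t₁ k h ih => exact ih hl
  | morphRet => cases hl
  | morphTau => cases hl
  | morphMove f x x' sw sw' sv sv' tv tw hf h hft htw hf' ih => cases hl; exact htw

/-- Two reductions at the same path are both silent with the same result, or both move; in the
latter case the initial state determines the transition and the result. -/
theorem Step.deterministic {π : Path} {t t₁ t₂ : Tree V A} {l₁ l₂ : Label V}
    (h₁ : Step π t l₁ t₁) (h₂ : Step π t l₂ t₂) :
    (l₁ = .tau ∧ l₂ = .tau ∧ t₁ = t₂) ∨
      ∃ r₁ tr₁ r₁' r₂ tr₂ r₂', l₁ = .move r₁ tr₁ r₁' ∧ l₂ = .move r₂ tr₂ r₂' ∧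
        (r₁ = r₂ → tr₁ = tr₂ ∧ r₁' = r₂' ∧ t₁ = t₂) := by
  induction h₁ with
  | act a r r' tr v hr ht =>
    cases h₂ with
    | act _ q q' tq w hq hq' =>
      refine Or.inr ⟨_, _, _, _, _, _, rfl, rfl, ?_⟩
      rintro rfl
      obtain ⟨rfl, rfl⟩ := Prod.mk.inj (Option.some.inj (hr.symm.trans hq))
      exact ⟨rfl, (Resource.isTransition _ tr.1 tr.2).functional _ _ _ ht hq', rfl⟩
  | seqRet v k => cases h₂; exact Or.inl ⟨rfl, rfl, rfl⟩
  | seqStep k h ih =>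
    cases h₂ with
    | seqStep _ h' =>
      rcases ih h' with ⟨a, b, c⟩ | ⟨r₁, tr₁, r₁', r₂, tr₂, r₂', a, b, c⟩
      · exact Or.inl ⟨a, b, by rw [c]⟩
      · exact Or.inr ⟨_, _, _, _, _, _, a, b, fun e => ⟨(c e).1, (c e).2.1, by rw [(c e).2.2]⟩⟩
  | parRet v₁ v₂ k => cases h₂; exact Or.inl ⟨rfl, rfl, rfl⟩
  | parL t₂ k h ih =>
    cases h₂ with
    | parL _ _ h' =>
      rcases ih h' with ⟨a, b, c⟩ | ⟨r₁, tr₁, r₁', r₂, tr₂, r₂', a, b, c⟩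
      · exact Or.inl ⟨a, b, by rw [c]⟩
      · exact Or.inr ⟨_, _, _, _, _, _, a, b, fun e => ⟨(c e).1, (c e).2.1, by rw [(c e).2.2]⟩⟩
  | parR t₁ k h ih =>
    cases h₂ with
    | parR _ _ h' =>
      rcases ih h' with ⟨a, b, c⟩ | ⟨r₁, tr₁, r₁', r₂, tr₂, r₂', a, b, c⟩
      · exact Or.inl ⟨a, b, by rw [c]⟩
      · exact Or.inr ⟨_, _, _, _, _, _, a, b, fun e => ⟨(c e).1, (c e).2.1, by rw [(c e).2.2]⟩⟩
  | morphRet f x v => cases h₂; exact Or.inl ⟨rfl, rfl, rfl⟩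
  | morphTau f x h ih =>
    cases h₂ with
    | morphTau _ _ h' =>
      rcases ih h' with ⟨_, _, c⟩ | ⟨r₁, tr₁, r₁', r₂, tr₂, r₂', a, _, _⟩
      · exact Or.inl ⟨rfl, rfl, by rw [c]⟩
      · cases a
    | morphMove _ _ x' sw sw' sv sv' tv tw hf h' hft htw hf' =>
      rcases ih h' with ⟨_, b, _⟩ | ⟨r₁, tr₁, r₁', r₂, tr₂, r₂', a, _, _⟩
      · cases b
      · cases a
  | morphMove f x x' sw sw' sv sv' tv tw hf h hft htw hf' ih =>
    cases h₂ with
    | morphTau _ _ h' =>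
      rcases ih h' with ⟨a, _, _⟩ | ⟨r₁, tr₁, r₁', r₂, tr₂, r₂', _, b, _⟩
      · cases a
      · cases b
    | morphMove _ _ y' rw rw' rv rv' uv uw gf h' gft gtw gf' =>
      refine Or.inr ⟨_, _, _, _, _, _, rfl, rfl, ?_⟩
      rintro rfl
      obtain rfl := Option.some.inj (hf.symm.trans gf)
      rcases ih h' with ⟨a, _, _⟩ | ⟨r₁, tr₁, r₁', r₂, tr₂, r₂', a, b, c⟩
      · cases a
      · cases a
        cases b
        obtain ⟨rfl, rfl, rfl⟩ := c rfl
        obtain rfl := Option.some.inj (hft.symm.trans gft)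
        obtain rfl := (Resource.isTransition _ tw.1 tw.2).functional _ _ _ htw gtw
        -- The new indices are not chosen by the step functionally; they agree because both relate
        -- to the same state of the source resource.
        obtain rfl := f.index_injective _ _ _ _ _ hf' gf'
        exact ⟨rfl, rfl, rfl⟩

theorem Red.deterministic {π : Path} {s s₁ s₂ : V.St} {t t₁ t₂ : Tree V A}
    (h₁ : Red π s t s₁ t₁) (h₂ : Red π s t s₂ t₂) : s₁ = s₂ ∧ t₁ = t₂ := by
  rcases h₁ with ⟨h₁, rfl⟩ | ⟨tr₁, h₁⟩ <;> rcases h₂ with ⟨h₂, rfl⟩ | ⟨tr₂, h₂⟩ <;>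
    rcases h₁.deterministic h₂ with ⟨a, b, c⟩ | ⟨r₁, u₁, r₁', r₂, u₂, r₂', a, b, c⟩ <;>
    cases a <;> cases b
  · exact ⟨rfl, c⟩
  · exact (c rfl).2

theorem Step.redex {π : Path} {t t' : Tree V A} {l : Label V} (h : Step π t l t') :
    Redex π t := by
  induction h with
  | act => exact .act _
  | seqRet => exact .seqRet _ _
  | seqStep k _ ih => exact .seqStep k ih
  | parRet => exact .parRet _ _ _
  | parL t₂ k _ ih => exact .parL t₂ k ih
  | parR t₁ k _ ih => exact .parR t₁ k ih
  | morphRet => exact .morphRet _ _ _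
  | morphTau f x _ ih => exact .morphStep f x ih
  | morphMove f x _ _ _ _ _ _ _ _ _ _ _ _ ih => exact .morphStep f x ih

theorem Red.redex {π : Path} {s s' : V.St} {t t' : Tree V A} (h : Red π s t s' t') :
    Redex π t := by
  rcases h with ⟨h, -⟩ | ⟨_, h⟩ <;> exact h.redex

/-- Locality of reductions: a reduction from `s ⊳ p` is also one from `s ⊲ p`. -/
theorem Step.locality {π : Path} {t t' : Tree V A} {s : SState V.M V.T} {p : V.M}
    {sl sr sr' : V.St} {tr : V.Tr} (h : Step π t (.move sr tr sr') t')
    (hl : s.selfFrame p = some sl.1) (hr : s.otherFrame p = some sr.1) :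
    ∃ (s' : SState V.M V.T) (sl' : V.St), s'.otherFrame p = some sr'.1 ∧
      s'.selfFrame p = some sl'.1 ∧ Step π t (.move sl tr sl') t' := by
  generalize hlab : Label.move sr tr sr' = l at h
  induction h with
  | act a r r' tr' v hrun ht =>
    cases hlab
    obtain ⟨s', sl', h₁, h₂, h₃⟩ :=
      (Resource.isTransition _ tr'.1 tr'.2).locality _ _ _ _ _ hl hr ht
    exact ⟨s', sl', h₁, h₂, .act a sl sl' tr' v (a.locality _ _ _ _ _ _ hl hr hrun) h₃⟩
  | seqRet => cases hlab
  | seqStep k h ih =>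
    obtain ⟨s', sl', h₁, h₂, h₃⟩ := ih hl hr hlab
    exact ⟨s', sl', h₁, h₂, .seqStep k h₃⟩
  | parRet => cases hlab
  | parL t₂ k h ih =>
    obtain ⟨s', sl', h₁, h₂, h₃⟩ := ih hl hr hlab
    exact ⟨s', sl', h₁, h₂, .parL t₂ k h₃⟩
  | parR t₁ k h ih =>
    obtain ⟨s', sl', h₁, h₂, h₃⟩ := ih hl hr hlab
    exact ⟨s', sl', h₁, h₂, .parR t₁ k h₃⟩
  | morphRet => cases hlab
  | morphTau => cases hlab
  | @morphMove V W A X π t t' f x x' sw sw' sv sv' tv tw hf h hft htw hf' ih =>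
    cases hlab
    obtain ⟨φ, hφ⟩ := f.state_locality
    obtain ⟨b, svl, hb₁, hb₂, hb₃⟩ := hφ x _ _ _ _ _ hl hr hf
    obtain ⟨c, svl', hc₁, hc₂, hc₃⟩ := ih hb₂ hb₁ rfl
    have locw := W.isTransition tw.1 tw.2
    obtain ⟨z, sl', hz₁, hz₂, hz₃⟩ := locw.locality _ _ _ _ _ hl hr htw
    obtain ⟨y, yl, hy₁, hy₂, hy₃⟩ := hφ x' _ _ _ _ _ hz₂ hz₁ hf'
    -- `y` comes from locality of `f` after the step, `c` from locality of the body. Both frame to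
    -- `sv'`, hence share *self* and *joint*. Their *other* components agree because transitions fix
    -- *other* on both sides and `f` sends equal *other* to equal *other*, even across indices.
    -- Using one `φ` for `x` and `x'` makes the two frames equal.
    have hyc : y.other = c.other := by
      have e₁ := f.other_fixed x x' sl sl' _ _ (locw.other_fixed _ _ hz₃) hb₃ hy₃
      have e₂ := (V.isTransition tv.1 tv.2).other_fixed _ _ hc₃.trans
      rw [selfFrame_eq_some] at hy₂ hc₂
      exact hy₂.2.2.symm.trans (e₁.symm.trans (e₂.trans hc₂.2.2))
    obtain rfl := otherFrame_injective hy₁ hc₁ hyc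
    obtain rfl : yl = svl' := Subtype.ext (Option.some.inj (hy₂.symm.trans hc₂))
    exact ⟨z, sl', hz₁, hz₂, .morphMove f x x' _ _ _ _ tv tw hb₃ hc₃
      (f.trans_locality x _ _ _ _ _ _ hl hr hft) hz₃ hy₃⟩

/-- A reduction in the left child is one in the parent; the right child idles or other-steps. -/
theorem Red.split {π : Path} {s s₁ s₂ s₁' : V.St} {t t' : Tree V A}
    (hs : Split s.1 s₁.1 s₂.1) (h : Red π s₁ t s₁' t') :
    ∃ s' s₂' : V.St, Red π s t s' t' ∧ Split s'.1 s₁'.1 s₂'.1 ∧ V.OSteps s₂ s₂' := by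
  rcases h with ⟨h, rfl⟩ | ⟨tr, h⟩
  · exact ⟨s, s₂, Or.inl ⟨h, rfl⟩, hs, .refl⟩
  · obtain ⟨s', s₂', ht, hs', ho⟩ := tr.split hs h.trans
    obtain ⟨_, q, _, _, hq⟩ := h.locality hs.frames.1 hs.frames.2
    -- Splitting and locality each produce a target for the parent; functionality of `tr` identifies
    -- them.
    obtain rfl := (V.isTransition tr.1 tr.2).functional _ _ _ ht hq.trans
    exact ⟨s', s₂', Or.inr ⟨tr, hq⟩, hs', .single ho⟩

theorem Safe.split {s s₁ s₂ : V.St} {t : Tree V A} (hs : Split s.1 s₁.1 s₂.1)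
    (h : Safe s₁ t) : Safe s t := by
  intro π hπ
  obtain ⟨s₁', t', hr⟩ := h π hπ
  obtain ⟨s', _, hr', _⟩ := hr.split hs
  exact ⟨s', t', hr'⟩

/-- A reduction in the parent comes from the left child, if the tree is safe there. -/
theorem Red.of_split {π : Path} {s s₁ s₂ s' : V.St} {t t' : Tree V A}
    (hs : Split s.1 s₁.1 s₂.1) (hsafe : Safe s₁ t) (h : Red π s t s' t') :
    ∃ s₁' s₂' : V.St, Red π s₁ t s₁' t' ∧ Split s'.1 s₁'.1 s₂'.1 ∧ V.OSteps s₂ s₂' := by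
  -- The larger *self* of the parent could enable more than the child can do. Safety of the child
  -- excludes this: it reduces at the same path, the parent follows, and determinism leaves no other
  -- outcome.
  obtain ⟨s₁', t'', hr⟩ := hsafe π h.redex
  obtain ⟨q, s₂', hr', hsp, ho⟩ := hr.split hs
  obtain ⟨rfl, rfl⟩ := h.deterministic hr'
  exact ⟨s₁', s₂', hr, hsp, ho⟩

theorem not_step_ret {π : Path} {v : A} {l : Label V} {t' : Tree V A} :
    ¬ Step π (.ret v) l t' := nofun

theorem not_red_ret {π : Path} {s s' : V.St} {v : A} {t' : Tree V A} :
    ¬ Red π s (.ret v) s' t' := by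
  rintro (⟨h, -⟩ | ⟨_, h⟩) <;> exact not_step_ret h

theorem not_red_unfinished {π : Path} {s s' : V.St} {t' : Tree V A} :
    ¬ Red π s .unfinished s' t' := by
  rintro (⟨h, -⟩ | ⟨_, h⟩) <;> cases h

theorem Safe.ret {s : V.St} {v : A} : Safe s (.ret v) := fun _ h => nomatch h

end Step

/-! ### The predicate `After` -/

namespace After

variable {V : Resource Loc Val} {A : Type u} {Q : A → V.St → Prop} {s s' : V.St}
  {t t' : Tree V A}

/-- Coinduction: `After` contains every invariant of configurations that implies safety and the
postcondition. -/
theorem of_invariant (R : V.St → Tree V A → Prop) (hsafe : ∀ s t, R s t → Safe s t)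
    (hpost : ∀ s v, R s (.ret v) → Q v s)
    (henv : ∀ s s' t, R s t → V.OStep s s' → R s' t)
    (hprog : ∀ π s s' t t', R s t → Red π s t s' t' → R s' t') (h : R s t) : After s t Q := by
  intro s' t' hst
  have key : R s' t' := by
    generalize hc : (s', t') = c at hst
    induction hst generalizing s' t' with
    | refl => cases hc; exact h
    | tail _ hstep ih =>
      cases hstep with
      | env r r' u ho => cases hc; exact henv _ _ _ (ih _ _ rfl) ho
      | prog π r r' u u' hr => cases hc; exact hprog _ _ _ _ _ (ih _ _ rfl) hr
  exact ⟨hsafe _ _ key, by rintro v rfl; exact hpost _ _ key⟩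

theorem safe (h : After s t Q) : Safe s t := (h _ _ .refl).1

theorem post {v : A} (h : After s (.ret v) Q) : Q v s := (h _ _ .refl).2 v rfl

theorem env (h : After s t Q) (ho : V.OSteps s s') : After s' t Q := by
  have : Relation.ReflTransGen CfgStep (s, t) (s', t) :=
    Relation.ReflTransGen.lift (fun r => (r, t)) (fun _ _ hr => CfgStep.env _ _ _ hr) _ _ ho
  exact fun r u hr => h r u (this.trans hr)

theorem prog {π : Path} (h : After s t Q) (hr : Red π s t s' t') : After s' t' Q :=
  fun r u hu => h r u (.head (CfgStep.prog _ _ _ _ _ hr) hu)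

theorem mono {Q' : A → V.St → Prop} (h : After s t Q) (hQ : ∀ v s, Q v s → Q' v s) :
    After s t Q' :=
  fun r u hu => ⟨(h r u hu).1, fun v hv => hQ _ _ ((h r u hu).2 v hv)⟩

theorem unfinished : After s .unfinished Q := by
  refine of_invariant (fun _ t => t = .unfinished) ?_ ?_ ?_ ?_ rfl
  · rintro s t rfl π h
    cases h
  · intro s v h
    cases h
  · exact fun _ _ _ h _ => h
  · rintro π s s' t t' rfl h
    exact (not_red_unfinished h).elim

theorem ret {v : A} (h : V.stab (Q v) s) : After s (.ret v) Q := by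
  refine of_invariant (fun s t => t = .ret v ∧ V.stab (Q v) s) ?_ ?_ ?_ ?_ ⟨rfl, h⟩
  · rintro s t ⟨rfl, -⟩
    exact .ret
  · rintro s w ⟨hw, h⟩
    cases hw
    exact h s .refl
  · exact fun s s' t ⟨ht, h⟩ ho => ⟨ht, fun r hr => h r (.head ho hr)⟩
  · rintro π s s' t t' ⟨rfl, -⟩ h
    exact (not_red_ret h).elim

/-- For the identity morphism the simulation clauses say that `J` survives every transition and
every other-step, so it can be carried along with `After`. -/
theorem invariant {J : V.St → Prop} (hJ : IsInvariant V J) (hs : J s) (h : After s t Q) :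
    After s t (fun v s => Q v s ∧ J s) := by
  refine of_invariant (fun s t => J s ∧ After s t Q) ?_ ?_ ?_ ?_ ⟨hs, h⟩
  · exact fun s t h => h.2.safe
  · exact fun s v h => ⟨h.2.post, h.1⟩
  · exact fun s s' t h ho => ⟨(hJ.backward s s' s h.1 rfl (.single ho)).1, h.2.env (.single ho)⟩
  · refine fun π s s' t t' h hr => ⟨?_, h.2.prog hr⟩
    rcases hr with ⟨_, rfl⟩ | ⟨tr, hr⟩
    · exact h.1
    · obtain ⟨_, q, _, hq, hq', _⟩ := hJ.forward s s s' tr h.1 rfl hr.trans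
      cases hq'
      exact hq

/-- The postcondition demanded of the first tree at a returned value is `After` for the
continuation. The relation therefore changes from its first to its second disjunct exactly when the
silent step discards the returned value. -/
theorem seq {B : Type u} {t : Tree V B} {k : B → Tree V A}
    (h : After s t (fun v s => After s (k v) Q)) : After s (.seq t k) Q := by
  refine of_invariant (fun s u => (∃ t, u = .seq t k ∧ After s t (fun v s => After s (k v) Q)) ∨
    After s u Q) ?_ ?_ ?_ ?_ (Or.inl ⟨t, rfl, h⟩)
  · rintro s u (⟨t, rfl, h⟩ | h)
    · intro π hπ
      cases hπ with
      | seqRet v _ => exact ⟨_, _, Or.inl ⟨.seqRet v k, rfl⟩⟩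
      | seqStep _ hπ =>
        obtain ⟨s', t', ⟨hr, rfl⟩ | ⟨tr, hr⟩⟩ := h.safe _ hπ
        · exact ⟨_, _, Or.inl ⟨.seqStep k hr, rfl⟩⟩
        · exact ⟨_, _, Or.inr ⟨tr, .seqStep k hr⟩⟩
    · exact h.safe
  · rintro s v (⟨t, ht, h⟩ | h)
    · cases ht
    · exact h.post
  · rintro s s' u (⟨t, rfl, h⟩ | h) ho
    · exact Or.inl ⟨t, rfl, h.env (.single ho)⟩
    · exact Or.inr (h.env (.single ho))
  · rintro π s s' u u' (⟨t, rfl, h⟩ | h) hr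
    · rcases hr with ⟨hr, rfl⟩ | ⟨tr, hr⟩
      · cases hr with
        | seqRet v _ => exact Or.inr h.post
        | seqStep _ hr => exact Or.inl ⟨_, rfl, h.prog (Or.inl ⟨hr, rfl⟩)⟩
      · cases hr with
        | seqStep _ hr => exact Or.inl ⟨_, rfl, h.prog (Or.inr ⟨tr, hr⟩)⟩
    · exact Or.inr (h.prog hr)

/-- The framed part behaves as an idle sibling: reductions of `t` reach it only as other-steps,
against which `V.stab Q₂` is closed. -/
theorem frame {Q₂ : V.St → Prop} {s₁ s₂ : V.St} (hs : Split s.1 s₁.1 s₂.1)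
    (h₁ : After s₁ t Q) (h₂ : V.stab Q₂ s₂) : After s t (fun v => V.sep (Q v) Q₂) := by
  refine of_invariant (fun s t => V.sep (fun s₁ => After s₁ t Q) (V.stab Q₂) s) ?_ ?_ ?_ ?_
    ⟨s₁, s₂, hs, h₁, h₂⟩
  · exact fun s t ⟨s₁, s₂, hs, h₁, _⟩ => h₁.safe.split hs
  · exact fun s v ⟨s₁, s₂, hs, h₁, h₂⟩ => ⟨s₁, s₂, hs, h₁.post, h₂ _ .refl⟩
  · rintro s s' t ⟨s₁, s₂, hs, h₁, h₂⟩ ho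
    obtain ⟨s₁', s₂', hs', ho₁, ho₂⟩ := ho.split hs
    exact ⟨s₁', s₂', hs', h₁.env (.single ho₁), fun r hr => h₂ r (.head ho₂ hr)⟩
  · rintro π s s' t t' ⟨s₁, s₂, hs, h₁, h₂⟩ hr
    obtain ⟨s₁', s₂', hr₁, hs', ho⟩ := hr.of_split hs h₁.safe
    exact ⟨s₁', s₂', hs', h₁.prog hr₁, fun r hr => h₂ r (ho.trans hr)⟩

/-- Threads that run from the two children of a state can run in parallel from that state. -/
theorem par {B₁ B₂ : Type u} {Q₁ : B₁ → V.St → Prop} {Q₂ : B₂ → V.St → Prop} {s₁ s₂ : V.St}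
    {t₁ : Tree V B₁} {t₂ : Tree V B₂} (hs : Split s.1 s₁.1 s₂.1) (h₁ : After s₁ t₁ Q₁)
    (h₂ : After s₂ t₂ Q₂) :
    After s (.par t₁ t₂ .ret) (fun v => V.sep (Q₁ v.1) (Q₂ v.2)) := by
  -- The second disjunct keeps the split and both finished threads after the join, so that
  -- interference arriving then is still distributed to the children and the two postconditions
  -- remain available.
  refine of_invariant (fun s u => ∃ s₁ s₂ : V.St, Split s.1 s₁.1 s₂.1 ∧
    ∃ (t₁ : Tree V B₁) (t₂ : Tree V B₂), After s₁ t₁ Q₁ ∧ After s₂ t₂ Q₂ ∧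
      (u = .par t₁ t₂ .ret ∨ ∃ v₁ v₂, t₁ = .ret v₁ ∧ t₂ = .ret v₂ ∧ u = .ret (v₁, v₂)))
    ?_ ?_ ?_ ?_ ⟨s₁, s₂, hs, t₁, t₂, h₁, h₂, Or.inl rfl⟩
  · rintro s u ⟨s₁, s₂, hs, t₁, t₂, h₁, h₂, rfl | ⟨v₁, v₂, rfl, rfl, rfl⟩⟩
    · intro π hπ
      cases hπ with
      | parRet v₁ v₂ _ => exact ⟨_, _, Or.inl ⟨.parRet v₁ v₂ _, rfl⟩⟩
      | parL _ _ hπ =>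
        obtain ⟨s', t', ⟨hr, rfl⟩ | ⟨tr, hr⟩⟩ := h₁.safe.split hs _ hπ
        · exact ⟨_, _, Or.inl ⟨.parL t₂ _ hr, rfl⟩⟩
        · exact ⟨_, _, Or.inr ⟨tr, .parL t₂ _ hr⟩⟩
      | parR _ _ hπ =>
        obtain ⟨s', t', ⟨hr, rfl⟩ | ⟨tr, hr⟩⟩ := h₂.safe.split hs.symm _ hπ
        · exact ⟨_, _, Or.inl ⟨.parR t₁ _ hr, rfl⟩⟩
        · exact ⟨_, _, Or.inr ⟨tr, .parR t₁ _ hr⟩⟩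
    · exact .ret
  · rintro s v ⟨s₁, s₂, hs, t₁, t₂, h₁, h₂, hu | ⟨v₁, v₂, rfl, rfl, hu⟩⟩
    · cases hu
    · cases hu
      exact ⟨s₁, s₂, hs, h₁.post, h₂.post⟩
  · rintro s s' u ⟨s₁, s₂, hs, t₁, t₂, h₁, h₂, hu⟩ ho
    obtain ⟨s₁', s₂', hs', ho₁, ho₂⟩ := ho.split hs
    exact ⟨s₁', s₂', hs', t₁, t₂, h₁.env (.single ho₁), h₂.env (.single ho₂), hu⟩
  · rintro π s s' u u' ⟨s₁, s₂, hs, t₁, t₂, h₁, h₂, rfl | ⟨v₁, v₂, rfl, rfl, rfl⟩⟩ hr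
    · have left : ∀ {π t₁'}, Red π s t₁ s' t₁' → ∃ s₁' s₂' : V.St, Split s'.1 s₁'.1 s₂'.1 ∧
          After s₁' t₁' Q₁ ∧ After s₂' t₂ Q₂ := fun hr => by
        obtain ⟨s₁', s₂', hr₁, hs', ho⟩ := hr.of_split hs h₁.safe
        exact ⟨s₁', s₂', hs', h₁.prog hr₁, h₂.env ho⟩
      have right : ∀ {π t₂'}, Red π s t₂ s' t₂' → ∃ s₁' s₂' : V.St, Split s'.1 s₁'.1 s₂'.1 ∧
          After s₁' t₁ Q₁ ∧ After s₂' t₂' Q₂ := fun hr => by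
        obtain ⟨s₂', s₁', hr₂, hs', ho⟩ := hr.of_split hs.symm h₂.safe
        exact ⟨s₁', s₂', hs'.symm, h₁.env ho, h₂.prog hr₂⟩
      rcases hr with ⟨hr, rfl⟩ | ⟨tr, hr⟩
      · cases hr with
        | parRet v₁ v₂ _ =>
          exact ⟨s₁, s₂, hs, _, _, h₁, h₂, Or.inr ⟨v₁, v₂, rfl, rfl, rfl⟩⟩
        | parL _ _ hr =>
          obtain ⟨s₁', s₂', hs', h₁', h₂'⟩ := left (Or.inl ⟨hr, rfl⟩)
          exact ⟨s₁', s₂', hs', _, _, h₁', h₂', Or.inl rfl⟩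
        | parR _ _ hr =>
          obtain ⟨s₁', s₂', hs', h₁', h₂'⟩ := right (Or.inl ⟨hr, rfl⟩)
          exact ⟨s₁', s₂', hs', _, _, h₁', h₂', Or.inl rfl⟩
      · cases hr with
        | parL _ _ hr =>
          obtain ⟨s₁', s₂', hs', h₁', h₂'⟩ := left (Or.inr ⟨tr, hr⟩)
          exact ⟨s₁', s₂', hs', _, _, h₁', h₂', Or.inl rfl⟩
        | parR _ _ hr =>
          obtain ⟨s₁', s₂', hs', h₁', h₂'⟩ := right (Or.inr ⟨tr, hr⟩)
          exact ⟨s₁', s₂', hs', _, _, h₁', h₂', Or.inl rfl⟩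
    · exact (not_red_ret hr).elim

/-- Until the action fires, stabilization keeps it enabled. When it fires, determinism identifies
the result with the one promised, and the stabilized postcondition takes over as for an idle
program. -/
theorem act {a : Action V A}
    (h : V.stab (fun s' => ∃ s'' v, a.Effect s' s'' v ∧ V.stab (Q v) s'') s) :
    After s (.act a) Q := by
  refine of_invariant (fun s u =>
    (u = .act a ∧ V.stab (fun s' => ∃ s'' v, a.Effect s' s'' v ∧ V.stab (Q v) s'') s) ∨
      After s u Q) ?_ ?_ ?_ ?_ (Or.inl ⟨rfl, h⟩)
  · rintro s u (⟨rfl, h⟩ | h)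
    · intro π hπ
      cases hπ
      obtain ⟨s'', v, ⟨tr, hrun, ht⟩, _⟩ := h s .refl
      exact ⟨s'', _, Or.inr ⟨tr, .act a s s'' tr v hrun ht⟩⟩
    · exact h.safe
  · rintro s v (⟨hv, _⟩ | h)
    · cases hv
    · exact h.post
  · rintro s s' u (⟨rfl, h⟩ | h) ho
    · exact Or.inl ⟨rfl, fun r hr => h r (.head ho hr)⟩
    · exact Or.inr (h.env (.single ho))
  · rintro π s s' u u' (⟨rfl, h⟩ | h) hr
    · obtain ⟨s'', v, ⟨tr, hrun, ht⟩, hQ⟩ := h s .refl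
      have hred : Red .act s (.act a) s'' (.ret v) := Or.inr ⟨tr, .act a s s'' tr v hrun ht⟩
      cases hr.redex
      obtain ⟨rfl, rfl⟩ := hr.deterministic hred
      exact Or.inr (ret hQ)
    · exact Or.inr (h.prog hr)

theorem morph {W : Resource Loc Val} {X : Type u} {f : Family V W X} {I : X → W.St → Prop}
    (hI : f.IsSimulation I) {x : X} {sw : W.St} {sv : V.St} (hf : f.onState x sw = some sv)
    (hIx : I x sw) (h : After sv t Q) :
    After sw (.morph f x t) (fun v sw' => ∃ y, f.lift y (Q v) sw' ∧ I y sw') := by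
  -- The second disjunct retains the index, the related state and the simulation after `.morph f x
  -- (.ret v)` has become `.ret v`; they are still needed to answer later interference.
  refine of_invariant (fun sw u => ∃ x sv t, f.onState x sw = some sv ∧ I x sw ∧ After sv t Q ∧
    (u = .morph f x t ∨ ∃ v, t = .ret v ∧ u = .ret v)) ?_ ?_ ?_ ?_
    ⟨x, sv, t, hf, hIx, h, Or.inl rfl⟩
  · rintro sw u ⟨x, sv, t, hf, hIx, h, rfl | ⟨v, rfl, rfl⟩⟩
    · intro π hπ
      cases hπ with
      | morphRet _ _ v => exact ⟨_, _, Or.inl ⟨.morphRet f x v, rfl⟩⟩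
      | morphStep _ _ hπ =>
        obtain ⟨sv', t', ⟨hr, rfl⟩ | ⟨tr, hr⟩⟩ := h.safe _ hπ
        · exact ⟨_, _, Or.inl ⟨.morphTau f x hr, rfl⟩⟩
        · obtain ⟨x', tw, sw', ht, _, hf', hw⟩ := hI.forward x sw sv sv' tr hIx hf hr.trans
          exact ⟨_, _, Or.inr ⟨tw, .morphMove f x x' sw sw' sv sv' tr tw hf hr ht hw hf'⟩⟩
    · exact .ret
  · rintro sw v ⟨x, sv, t, hf, hIx, h, hu | ⟨v, rfl, hu⟩⟩
    · cases hu
    · cases hu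
      exact ⟨x, ⟨sv, hf, h.post⟩, hIx⟩
  · rintro sw sw' u ⟨x, sv, t, hf, hIx, h, hu⟩ ho
    obtain ⟨hI', sv', hf', ho'⟩ := hI.backward x sw sw' sv hIx hf (.single ho)
    exact ⟨x, sv', t, hf', hI', h.env ho', hu⟩
  · rintro π sw sw' u u' ⟨x, sv, t, hf, hIx, h, rfl | ⟨v, rfl, rfl⟩⟩ hr
    · rcases hr with ⟨hr, rfl⟩ | ⟨tw, hr⟩
      · cases hr with
        | morphRet _ _ v => exact ⟨x, sv, _, hf, hIx, h, Or.inr ⟨v, rfl, rfl⟩⟩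
        | morphTau _ _ hr => exact ⟨x, sv, _, hf, hIx, h.prog (Or.inl ⟨hr, rfl⟩), Or.inl rfl⟩
      · cases hr with
        | morphMove _ _ x' _ _ rv sv' tv _ hf₁ hr hft hw hf' =>
          obtain rfl := Option.some.inj (hf.symm.trans hf₁)
          obtain ⟨y, tw', q, hft', hIy, hfy, hw'⟩ := hI.forward x sw sv sv' tv hIx hf hr.trans
          obtain rfl := Option.some.inj (hft.symm.trans hft')
          obtain rfl := (W.isTransition tw.1 tw.2).functional _ _ _ hw hw'
          obtain rfl := f.index_injective _ _ _ _ _ hf' hfy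
          exact ⟨x', sv', _, hf', hIy, h.prog (Or.inr ⟨tv, hr⟩), Or.inl rfl⟩
    · exact (not_red_ret hr).elim

end After

/-! ### Inference rules -/

section Rules

variable {V W : Resource Loc Val} {A : Type u}

theorem vrf_morphX {X : Type u} {f : Family V W X} {I : X → W.St → Prop} {x : X} {e : ST V A}
    {Q : A → V.St → Prop} {sw : W.St} (hI : f.IsSimulation I) (h : f.lift x (vrf e Q) sw)
    (hx : I x sw) :
    vrf (ST.morphX f x e) (fun v sw' => ∃ y, f.lift y (Q v) sw' ∧ I y sw') sw := by
  obtain ⟨sv, hf, h⟩ := h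
  rintro _ (rfl | ⟨t, ht, rfl⟩)
  · exact .unfinished
  · exact .morph hI hf hx (h t ht)

theorem Morphism.IsSimulation.toFamily {f : Morphism V W} {I : W.St → Prop}
    (h : f.IsSimulation I) : f.toFamily.IsSimulation (fun _ => I) where
  forward _ sw sv sv' tv hI hf ht := ⟨PUnit.unit, h.forward sw sv sv' tv hI hf ht⟩
  backward _ := h.backward

theorem vrf_morph {f : Morphism V W} {I : W.St → Prop} {e : ST V A}
    {Q : A → V.St → Prop} {sw : W.St} (hI : f.IsSimulation I) (h : f.lift (vrf e Q) sw)
    (hsw : I sw) : vrf (ST.morph f e) (fun v sw' => f.lift (Q v) sw' ∧ I sw') sw :=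
  fun t ht => (vrf_morphX (x := PUnit.unit) hI.toFamily h hsw t ht).mono
    fun _ _ ⟨_, hy⟩ => hy

/-- The trees that meet the specification form a pre-fixed point of the monotone completion, since
`F` takes values in the Hoare type. The least fixed point, an infimum of pre-fixed points, lies
below it. -/
theorem fix_mem_hoare {B : A → Type u} {Γ : A → Type w} {P : ∀ x, Γ x → V.St → Prop}
    {Q : ∀ x, Γ x → B x → V.St → Prop}
    (F : {e : ∀ x, ST V (B x) | ∀ x, e x ∈ Hoare (P x) (Q x)} →
      {e : ∀ x, ST V (B x) | ∀ x, e x ∈ Hoare (P x) (Q x)}) (x : A) :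
    ST.fix F x ∈ Hoare (P x) (Q x) := by
  intro γ s hP t ht
  -- The largest member of the Hoare type; it contains `.unfinished`, which meets every
  -- specification.
  let top : ∀ x, ST V (B x) := fun x =>
    ⟨{t | ∀ γ s, P x γ s → After s t (Q x γ)}, fun _ _ _ => .unfinished⟩
  exact ht top (fun e' _ y u hu γ s hP => (F e').2 y γ s hP u hu) γ s hP

end Rules

end Morphing

/-! ### Soundness: assembly of the rules -/

open Morphing in
theorem mainTheorem1 {Loc Val : Type u} :
    -- vrf_post
    (∀ (V : Resource Loc Val) (A : Type u) (e : ST V A) (J : V.St → Prop)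
        (Q₁ Q₂ : A → V.St → Prop) (s : V.St),
      IsInvariant V J → (∀ v s, J s → Q₁ v s → Q₂ v s) → J s → vrf e Q₁ s → vrf e Q₂ s) ∧
    -- vrf_ret
    (∀ (V : Resource Loc Val) (A : Type u) (v : A) (Q : A → V.St → Prop) (s : V.St),
      V.stab (Q v) s → vrf (ST.ret v) Q s) ∧
    -- vrf_bnd
    (∀ (V : Resource Loc Val) (A B : Type u) (e₁ : ST V B) (e₂ : B → ST V A)
        (Q : A → V.St → Prop) (s : V.St),
      vrf e₁ (fun x => vrf (e₂ x) Q) s → vrf (ST.bnd e₁ e₂) Q s) ∧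
    -- vrf_par
    (∀ (V : Resource Loc Val) (A₁ A₂ : Type u) (e₁ : ST V A₁) (e₂ : ST V A₂)
        (Q₁ : A₁ → V.St → Prop) (Q₂ : A₂ → V.St → Prop) (s : V.St),
      V.sep (vrf e₁ Q₁) (vrf e₂ Q₂) s →
        vrf (ST.par e₁ e₂) (fun v => V.sep (Q₁ v.1) (Q₂ v.2)) s) ∧
    -- vrf_frame
    (∀ (V : Resource Loc Val) (A : Type u) (e : ST V A) (Q₁ : A → V.St → Prop)
        (Q₂ : V.St → Prop) (s : V.St),
      V.sep (vrf e Q₁) (V.stab Q₂) s → vrf e (fun v => V.sep (Q₁ v) Q₂) s) ∧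
    -- vrf_act
    (∀ (V : Resource Loc Val) (A : Type u) (a : Action V A) (Q : A → V.St → Prop) (s : V.St),
      V.stab (fun s' => ∃ s'' v, a.Effect s' s'' v ∧ V.stab (Q v) s'') s →
        vrf (ST.act a) Q s) ∧
    -- vrf_morph
    (∀ (V W : Resource Loc Val) (A : Type u) (f : Morphism V W) (I : W.St → Prop) (e : ST V A)
        (Q : A → V.St → Prop) (sw : W.St),
      f.IsSimulation I → f.lift (vrf e Q) sw → I sw →
        vrf (ST.morph f e) (fun v sw' => f.lift (Q v) sw' ∧ I sw') sw) ∧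
    -- the same rule for indexed families of morphisms
    (∀ (V W : Resource Loc Val) (A X : Type u) (f : Family V W X) (I : X → W.St → Prop) (x : X)
        (e : ST V A) (Q : A → V.St → Prop) (sw : W.St),
      f.IsSimulation I → f.lift x (vrf e Q) sw → I x sw →
        vrf (ST.morphX f x e) (fun v sw' => ∃ y, f.lift y (Q v) sw' ∧ I y sw') sw) ∧
    -- Morph, for Hoare types
    (∀ (V W : Resource Loc Val) (A : Type u) (Γ : Type w) (f : Morphism V W)
        (I : Γ → W.St → Prop) (P : Γ → V.St → Prop) (Q : Γ → A → V.St → Prop) (e : ST V A),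
      (∀ γ, f.IsSimulation (I γ)) → e ∈ Hoare P Q →
        ST.morph f e ∈ Hoare (fun γ sw => f.lift (P γ) sw ∧ I γ sw)
          (fun γ v sw => f.lift (Q γ v) sw ∧ I γ sw)) ∧
    -- MorphX, for Hoare types
    (∀ (V W : Resource Loc Val) (A X : Type u) (Γ : Type w) (f : Family V W X)
        (I : Γ → X → W.St → Prop) (x : X) (P : Γ → V.St → Prop) (Q : Γ → A → V.St → Prop)
        (e : ST V A),
      (∀ γ, f.IsSimulation (I γ)) → e ∈ Hoare P Q →
        ST.morphX f x e ∈ Hoare (fun γ sw => f.lift x (P γ) sw ∧ I γ x sw)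
          (fun γ v sw => ∃ y, f.lift y (Q γ v) sw ∧ I γ y sw)) ∧
    -- Fix: `fix : (T → T) → T` for `T = Π x : A, [Γ]. {P} B {Q} @ V`
    (∀ (V : Resource Loc Val) (A : Type u) (B : A → Type u) (Γ : A → Type w)
        (P : ∀ x, Γ x → V.St → Prop) (Q : ∀ x, Γ x → B x → V.St → Prop)
        (F : {e : ∀ x, ST V (B x) | ∀ x, e x ∈ Hoare (P x) (Q x)} →
          {e : ∀ x, ST V (B x) | ∀ x, e x ∈ Hoare (P x) (Q x)}),
      ∀ x, ST.fix F x ∈ Hoare (P x) (Q x)) := by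
  refine ⟨?_, ?_, ?_, ?_, ?_, ?_, ?_, ?_, ?_, ?_, ?_⟩
  · intro V A e J Q₁ Q₂ s hJ hQ hs h t ht
    exact ((h t ht).invariant hJ hs).mono fun v s hv => hQ v s hv.2 hv.1
  · rintro V A v Q s h _ (rfl | rfl)
    · exact .unfinished
    · exact .ret h
  · rintro V A B e₁ e₂ Q s h _ (rfl | ⟨t, k, ht, hk, rfl⟩)
    · exact .unfinished
    -- The continuation `k` of this particular tree selects one tree from each `e₂ x`, so `vrf (e₂
    -- x) Q` is specialized to it.
    · exact .seq ((h t ht).mono fun v s hv => hv _ (hk v))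
  · rintro V A₁ A₂ e₁ e₂ Q₁ Q₂ s ⟨s₁, s₂, hs, h₁, h₂⟩ _ (rfl | ⟨t₁, t₂, ht₁, ht₂, rfl⟩)
    · exact .unfinished
    · exact .par hs (h₁ t₁ ht₁) (h₂ t₂ ht₂)
  · rintro V A e Q₁ Q₂ s ⟨s₁, s₂, hs, h₁, h₂⟩ t ht
    exact .frame hs (h₁ t ht) h₂
  · rintro V A a Q s h _ (rfl | rfl)
    · exact .unfinished
    · exact .act h
  · exact fun V W A f I e Q sw hI h hsw => vrf_morph hI h hsw
  · exact fun V W A X f I x e Q sw hI h hx => vrf_morphX hI h hx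
  · exact fun V W A Γ f I P Q e hI he γ sw ⟨⟨sv, hf, hP⟩, hsw⟩ =>
      vrf_morph (hI γ) ⟨sv, hf, he γ sv hP⟩ hsw
  · exact fun V W A X Γ f I x P Q e hI he γ sw ⟨⟨sv, hf, hP⟩, hx⟩ =>
      vrf_morphX (hI γ) ⟨sv, hf, he γ sv hP⟩ hx
  · exact fun V A B Γ P Q F x => fix_mem_hoare F x
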